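/- Let $\mathbb{Z}_\infty$ (the surintegers) be the ring of formal differences of ordinals under the natural (Hessenberg) sum and product, ordered by $a-b\le c-d \iff a+d\le c+b$; let $\mathbb{Z}_\infty^+=\{z\in\mathbb{Z}_\infty: z\ge 0\}$, and let $\mathbb{Q}_\infty$ (the surrationals) be the field of fractions of $\mathbb{Z}_\infty$. A *naked polynomial* is a function $\mathfrak p=(\mathfrak p_\alpha)_{\alpha\in\mathbb{Z}_\infty^+}$ from $\mathbb{Z}_\infty^+$ to $\mathbb{Q}_\infty$ such that every nonempty subset of its support $\{\alpha:\mathfrak p_\alpha\ne 0\}$ has a greatest element. Naked polynomials form a commutative ring $\mathbb{Q}_\infty[X^{\mathbb{Z}_\infty^+}]$ under coordinatewise addition and the product $(\mathfrak p\mathfrak q)_\gamma=\sum_{\alpha+\beta=\gamma}\mathfrak p_\alpha\mathfrak q_\beta$ (each sum has only finitely many nonzero terms). For $\mathfrak p\neq 0$ let $\deg\mathfrak p\in\mathbb{Z}_\infty^+$ be the greatest element of the support of $\mathfrak p$; put $\deg 0=0$ by convention. **Theorem.** (1) For all $\mathfrak p,\mathfrak q\in\mathbb{Q}_\infty[X^{\mathbb{Z}_\infty^+}]$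 with $\mathfrak q\ne 0$ and $\deg\mathfrak q\le\deg\mathfrak p$, there is a unique pair $(\mathfrak r,\mathfrak s)$ of naked polynomials such that $$\mathfrak p=\mathfrak q\,\mathfrak r+\mathfrak s\quad\text{and}\quad \mathfrak s=0\ \text{ or }\ \deg\mathfrak s<\deg\mathfrak q.$$ (2) Accordingly, $\mathbb{Q}_\infty[X^{\mathbb{Z}_\infty^+}]$ is a Euclidean domain with $\mathbb{Z}_\infty^+$-valued norm $N(\mathfrak p)=\deg\mathfrak p$, in the following sense, in which the linearly ordered class of values of the norm is not required to be well-ordered (and $\mathbb{Z}_\infty^+$ is not: $\omega>\omega-1>\omega-2>\cdots$): it is an integral domain; for all $\mathfrak a$ and all $\mathfrak b\neq 0$ there are $\mathfrak r,\mathfrak s$ with $\mathfrak a=\mathfrak b\,\mathfrak r+\mathfrak s$ and $\mathfrak s=0$ or $N(\mathfrak s)<N(\mathfrak b)$; and $N(\mathfrak a)\le N(\mathfrak a\mathfrak b)$ for all nonzero $\mathfrak a,\mathfrak b$. -/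

import Mathlib

universe u

/-! ### The ordinals with the natural (Hessenberg) sum and product -/

/-- The class of all ordinals (of a universe), as a type that carries the natural (Hessenberg) sum
and product. The order is the usual one. -/
def NatOrdinal : Type (u + 1) := Ordinal.{u}

namespace NatOrdinal

noncomputable instance : ConditionallyCompleteLinearOrderBot NatOrdinal.{u} :=
  inferInstanceAs (ConditionallyCompleteLinearOrderBot Ordinal.{u})

instance : WellFoundedLT NatOrdinal.{u} := inferInstanceAs (WellFoundedLT Ordinal.{u})

noncomputable instance : WellFoundedRelation NatOrdinal.{u} := ⟨(· < ·), wellFounded_lt⟩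

noncomputable instance : Zero NatOrdinal.{u} := inferInstanceAs (Zero Ordinal.{u})

noncomputable instance : One NatOrdinal.{u} := inferInstanceAs (One Ordinal.{u})

/-- The natural sum: `nadd a b` is the least ordinal above all `nadd a' b` with `a' < a` and all
`nadd a b'` with `b' < b`. -/
noncomputable def nadd (a b : NatOrdinal.{u}) : NatOrdinal.{u} :=
  sInf {c | (∀ a', (_ : a' < a) → nadd a' b < c) ∧ (∀ b', (_ : b' < b) → nadd a b' < c)}
termination_by (a, b)

/-- The natural product: `nmul a b` is the least ordinal `c` such that
`nmul a' b + nmul a b' < c + nmul a' b'` (natural sums) for all `a' < a` and `b' < b`. -/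
noncomputable def nmul (a b : NatOrdinal.{u}) : NatOrdinal.{u} :=
  sInf {c | ∀ a', (_ : a' < a) → ∀ b', (_ : b' < b) →
    nadd (nmul a' b) (nmul a b') < nadd c (nmul a' b')}
termination_by (a, b)

noncomputable instance : Add NatOrdinal.{u} := ⟨nadd⟩

noncomputable instance : Mul NatOrdinal.{u} := ⟨nmul⟩

theorem zero_le' (a : NatOrdinal.{u}) : 0 ≤ a := by
  have h : ∀ x : Ordinal.{u}, 0 ≤ x := fun _ => zero_le
  exact h a

theorem lt_one_iff' (a : NatOrdinal.{u}) : a < 1 ↔ a = 0 := by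
  have h : ∀ x : Ordinal.{u}, x < 1 ↔ x = 0 := fun _ => Order.lt_one_iff
  exact h a

theorem zero_lt_one' : (0 : NatOrdinal.{u}) < 1 := (lt_one_iff' _).2 rfl

/-- A family of ordinals indexed by the ordinals below `a` has a strict upper bound. -/
theorem exists_ub (a : NatOrdinal.{u}) (f : NatOrdinal.{u} → NatOrdinal.{u}) :
    ∃ c, ∀ a' < a, f a' < c := by
  have h : ∀ (a : Ordinal.{u}) (f : Ordinal.{u} → Ordinal.{u}), ∃ c, ∀ a' < a, f a' < c := by
    intro a f
    obtain ⟨c, hc⟩ : BddAbove (f '' Set.Iio a) := Ordinal.bddAbove_of_small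
    exact ⟨Order.succ c, fun a' ha' => Order.lt_succ_iff.2 (hc ⟨a', ha', rfl⟩)⟩
  exact h a f

theorem nadd_spec (a b : NatOrdinal.{u}) :
    (∀ a' < a, a' + b < a + b) ∧ (∀ b' < b, a + b' < a + b) := by
  have hne : {c | (∀ a', (_ : a' < a) → nadd a' b < c) ∧
      (∀ b', (_ : b' < b) → nadd a b' < c)}.Nonempty := by
    obtain ⟨c, hc⟩ := exists_ub a (fun a' => nadd a' b)
    obtain ⟨d, hd⟩ := exists_ub b (fun b' => nadd a b')
    exact ⟨max c d, fun a' h => lt_max_of_lt_left (hc a' h),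
      fun b' h => lt_max_of_lt_right (hd b' h)⟩
  have := csInf_mem hne
  rw [← nadd] at this
  exact this

theorem add_le_of_forall {a b c : NatOrdinal.{u}} (h₁ : ∀ a' < a, a' + b < c)
    (h₂ : ∀ b' < b, a + b' < c) : a + b ≤ c := by
  change nadd a b ≤ c
  rw [nadd]
  exact csInf_le (OrderBot.bddBelow _) ⟨h₁, h₂⟩

theorem lt_add_iff' {a b c : NatOrdinal.{u}} :
    c < a + b ↔ (∃ a' < a, c ≤ a' + b) ∨ ∃ b' < b, c ≤ a + b' := by
  constructor
  · intro h
    by_contra! H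
    exact absurd h (not_lt.2 (add_le_of_forall H.1 H.2))
  · rintro (⟨a', ha', h⟩ | ⟨b', hb', h⟩)
    · exact h.trans_lt ((nadd_spec a b).1 a' ha')
    · exact h.trans_lt ((nadd_spec a b).2 b' hb')

theorem add_lt_left (a : NatOrdinal.{u}) {b c : NatOrdinal.{u}} (h : b < c) : a + b < a + c :=
  (nadd_spec a c).2 b h

theorem add_lt_right {b c : NatOrdinal.{u}} (h : b < c) (a : NatOrdinal.{u}) : b + a < c + a :=
  (nadd_spec c a).1 b h

protected theorem add_comm' (a b : NatOrdinal.{u}) : a + b = b + a := by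
  induction a using WellFoundedLT.induction generalizing b with
  | ind a iha =>
    induction b using WellFoundedLT.induction with
    | ind b ihb =>
      apply le_antisymm
      · apply add_le_of_forall
        · intro a' h; rw [iha a' h]; exact add_lt_left b h
        · intro b' h; rw [ihb b' h]; exact add_lt_right h a
      · apply add_le_of_forall
        · intro b' h; rw [← ihb b' h]; exact add_lt_left a h
        · intro a' h; rw [← iha a' h]; exact add_lt_right h b

protected theorem add_zero' (a : NatOrdinal.{u}) : a + 0 = a := by
  induction a using WellFoundedLT.induction with
  | ind a iha =>
    apply le_antisymm
    · apply add_le_of_forall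
      · intro a' h; rwa [iha a' h]
      · intro b' h; exact absurd h (not_lt.2 (zero_le' b'))
    · by_contra! h
      have h' := add_lt_right h 0
      rw [iha _ h] at h'
      exact lt_irrefl _ h'

protected theorem add_assoc' (a b c : NatOrdinal.{u}) : a + b + c = a + (b + c) := by
  induction a using WellFoundedLT.induction generalizing b c with
  | ind a iha =>
    induction b using WellFoundedLT.induction generalizing c with
    | ind b ihb =>
      induction c using WellFoundedLT.induction with
      | ind c ihc =>
        apply le_antisymm
        · apply add_le_of_forall
          · intro d hd
            rcases lt_add_iff'.1 hd with ⟨a', h, hle⟩ | ⟨b', h, hle⟩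
            · have h1 : d + c ≤ a' + b + c := by
                rcases hle.lt_or_eq with h2 | h2
                · exact (add_lt_right h2 c).le
                · rw [h2]
              rw [iha a' h] at h1
              exact h1.trans_lt (add_lt_right h _)
            · have h1 : d + c ≤ a + b' + c := by
                rcases hle.lt_or_eq with h2 | h2
                · exact (add_lt_right h2 c).le
                · rw [h2]
              rw [ihb b' h] at h1
              exact h1.trans_lt (add_lt_left _ (add_lt_right h _))
          · intro c' h
            rw [ihc c' h]
            exact add_lt_left _ (add_lt_left _ h)
        · apply add_le_of_forall
          · intro a' h
            rw [← iha a' h]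
            exact add_lt_right (add_lt_right h _) _
          · intro d hd
            rcases lt_add_iff'.1 hd with ⟨b', h, hle⟩ | ⟨c', h, hle⟩
            · have h1 : a + d ≤ a + (b' + c) := by
                rcases hle.lt_or_eq with h2 | h2
                · exact (add_lt_left a h2).le
                · rw [h2]
              rw [← ihb b' h] at h1
              exact h1.trans_lt (add_lt_right (add_lt_left _ h) _)
            · have h1 : a + d ≤ a + (b + c') := by
                rcases hle.lt_or_eq with h2 | h2
                · exact (add_lt_left a h2).le
                · rw [h2]
              rw [← ihc c' h] at h1
              exact h1.trans_lt (add_lt_left _ h)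

noncomputable instance : AddCommMonoid NatOrdinal.{u} where
  add_assoc := NatOrdinal.add_assoc'
  add_comm := NatOrdinal.add_comm'
  add_zero := NatOrdinal.add_zero'
  zero_add a := by rw [NatOrdinal.add_comm', NatOrdinal.add_zero']
  nsmul := nsmulRec

instance : IsOrderedCancelAddMonoid NatOrdinal.{u} :=
  have : AddLeftStrictMono NatOrdinal.{u} := ⟨fun a _ _ h => add_lt_left a h⟩
  { add_le_add_left := fun _ _ h c => h.lt_or_eq.elim (fun h => (add_lt_right h c).le)
      (fun h => by rw [h])
    le_of_add_le_add_left := fun a b c h => by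
      by_contra! H
      exact absurd h (not_le.2 (add_lt_left a H)) }

theorem nmul_spec {a b a' b' : NatOrdinal.{u}} (ha : a' < a) (hb : b' < b) :
    a' * b + a * b' < a * b + a' * b' := by
  have hne : {c : NatOrdinal.{u} | ∀ a', (_ : a' < a) → ∀ b', (_ : b' < b) →
      nadd (nmul a' b) (nmul a b') < nadd c (nmul a' b')}.Nonempty := by
    choose g hg using fun a' => exists_ub b (fun b' => a' * b + a * b')
    obtain ⟨c, hc⟩ := exists_ub a g
    refine ⟨c, fun a' ha' b' hb' => ?_⟩
    have h1 := (hg a' b' hb').trans (hc a' ha')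
    have h2 : c + 0 ≤ c + a' * b' := add_le_add le_rfl (zero_le' _)
    rw [add_zero] at h2
    exact h1.trans_le h2
  have := csInf_mem hne
  rw [← nmul] at this
  exact this a' ha b' hb

theorem mul_le_of_forall {a b c : NatOrdinal.{u}}
    (h : ∀ a' < a, ∀ b' < b, a' * b + a * b' < c + a' * b') : a * b ≤ c := by
  change nmul a b ≤ c
  rw [nmul]
  exact csInf_le (OrderBot.bddBelow _) h

theorem exists_of_lt_mul {a b c : NatOrdinal.{u}} (h : c < a * b) :
    ∃ a' < a, ∃ b' < b, c + a' * b' ≤ a' * b + a * b' := by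
  by_contra! H
  exact absurd h (not_lt.2 (mul_le_of_forall H))

theorem nmul_le {a b a' b' : NatOrdinal.{u}} (ha : a' ≤ a) (hb : b' ≤ b) :
    a' * b + a * b' ≤ a * b + a' * b' := by
  rcases ha.lt_or_eq with ha | rfl
  · rcases hb.lt_or_eq with hb | rfl
    · exact (nmul_spec ha hb).le
    · exact (add_comm _ _).le
  · exact le_rfl

protected theorem mul_comm' (a b : NatOrdinal.{u}) : a * b = b * a := by
  induction a using WellFoundedLT.induction generalizing b with
  | ind a iha =>
    induction b using WellFoundedLT.induction with
    | ind b ihb =>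
      apply le_antisymm
      · apply mul_le_of_forall
        intro a' ha b' hb
        rw [iha a' ha b, ihb b' hb, iha a' ha b', add_comm]
        exact nmul_spec hb ha
      · apply mul_le_of_forall
        intro b' hb a' ha
        rw [← iha a' ha b, ← ihb b' hb, ← iha a' ha b', add_comm]
        exact nmul_spec ha hb

protected theorem mul_zero' (a : NatOrdinal.{u}) : a * 0 = 0 :=
  le_antisymm (mul_le_of_forall fun _ _ b' hb => absurd hb (not_lt.2 (zero_le' b'))) (zero_le' _)

protected theorem mul_one' (a : NatOrdinal.{u}) : a * 1 = a := by
  induction a using WellFoundedLT.induction with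
  | ind a iha =>
    apply le_antisymm
    · apply mul_le_of_forall
      intro a' ha b' hb
      rw [(lt_one_iff' b').1 hb, NatOrdinal.mul_zero', NatOrdinal.mul_zero', iha a' ha]
      simpa using ha
    · by_contra! h
      have h1 := nmul_spec h zero_lt_one'
      rw [NatOrdinal.mul_zero', NatOrdinal.mul_zero', iha _ h] at h1
      exact lt_irrefl _ h1

protected theorem mul_add' (a b c : NatOrdinal.{u}) : a * (b + c) = a * b + a * c := by
  induction a using WellFoundedLT.induction generalizing b c with
  | ind a iha =>
    induction b using WellFoundedLT.induction generalizing c with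
    | ind b ihb =>
      induction c using WellFoundedLT.induction with
      | ind c ihc =>
        apply le_antisymm
        · apply mul_le_of_forall
          intro a' ha d hd
          rcases lt_add_iff'.1 hd with ⟨b', hb, hle⟩ | ⟨c', hc, hle⟩
          · have h1 := nmul_le ha.le hle
            rw [iha a' ha, ihb b' hb] at h1
            have h2 := nmul_spec ha hb
            rw [iha a' ha]
            grind
          · have h1 := nmul_le ha.le hle
            rw [iha a' ha, ihc c' hc] at h1
            have h2 := nmul_spec ha hc
            rw [iha a' ha]
            grind
        · apply add_le_of_forall
          · intro x hx
            obtain ⟨a', ha, b', hb, h⟩ := exists_of_lt_mul hx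
            have h1 := nmul_spec ha (add_lt_right hb c)
            rw [iha a' ha, iha a' ha, ihb b' hb] at h1
            grind
          · intro x hx
            obtain ⟨a', ha, c', hc, h⟩ := exists_of_lt_mul hx
            have h1 := nmul_spec ha (add_lt_left b hc)
            rw [iha a' ha, iha a' ha, ihc c' hc] at h1
            grind

protected theorem add_mul' (a b c : NatOrdinal.{u}) : (a + b) * c = a * c + b * c := by
  rw [NatOrdinal.mul_comm', NatOrdinal.mul_add', NatOrdinal.mul_comm' c, NatOrdinal.mul_comm' c]

theorem mul_assoc_le {a b c : NatOrdinal.{u}}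
    (h : ∀ x ≤ a, ∀ y ≤ b, ∀ z ≤ c, (x < a ∨ y < b ∨ z < c) → x * y * z = x * (y * z)) :
    a * b * c ≤ a * (b * c) := by
  apply mul_le_of_forall
  intro d hd c' hc
  obtain ⟨a', ha, b', hb, hle⟩ := exists_of_lt_mul hd
  have h1 := nmul_le hle hc.le
  have h2 := nmul_spec ha (nmul_spec hb hc)
  simp only [NatOrdinal.add_mul', NatOrdinal.mul_add'] at h1 h2
  rw [h a' ha.le b le_rfl c le_rfl (by simp [ha]), h a le_rfl b' hb.le c le_rfl (by simp [hb]),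
    h a' ha.le b' hb.le c le_rfl (by simp [ha]), h a' ha.le b le_rfl c' hc.le (by simp [ha]),
    h a le_rfl b' hb.le c' hc.le (by simp [hb]), h a' ha.le b' hb.le c' hc.le (by simp [ha])] at h1
  rw [h a le_rfl b le_rfl c' hc.le (by simp [hc])]
  grind

protected theorem mul_assoc' (a b c : NatOrdinal.{u}) : a * b * c = a * (b * c) := by
  induction a using WellFoundedLT.induction generalizing b c with
  | ind a iha =>
    induction b using WellFoundedLT.induction generalizing c with
    | ind b ihb =>
      induction c using WellFoundedLT.induction with
      | ind c ihc =>
        have h : ∀ x ≤ a, ∀ y ≤ b, ∀ z ≤ c, (x < a ∨ y < b ∨ z < c) →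
            x * y * z = x * (y * z) := by
          intro x hx y hy z hz h
          rcases hx.lt_or_eq with hx | rfl
          · exact iha x hx y z
          rcases hy.lt_or_eq with hy | rfl
          · exact ihb y hy z
          rcases hz.lt_or_eq with hz | rfl
          · exact ihc z hz
          simp at h
        apply le_antisymm (mul_assoc_le h)
        have h' : c * b * a ≤ c * (b * a) := by
          apply mul_assoc_le
          intro z hz y hy x hx hlt
          have := h x hx y hy z hz (by tauto)
          rw [NatOrdinal.mul_comm' (z * y), NatOrdinal.mul_comm' z y, ← this,
            NatOrdinal.mul_comm' z, NatOrdinal.mul_comm' y x]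
        rwa [NatOrdinal.mul_comm' (c * b), NatOrdinal.mul_comm' c b, NatOrdinal.mul_comm' c,
          NatOrdinal.mul_comm' b a] at h'

noncomputable instance : CommSemiring NatOrdinal.{u} where
  left_distrib := NatOrdinal.mul_add'
  right_distrib := NatOrdinal.add_mul'
  zero_mul a := by rw [NatOrdinal.mul_comm', NatOrdinal.mul_zero']
  mul_zero := NatOrdinal.mul_zero'
  mul_assoc := NatOrdinal.mul_assoc'
  one_mul a := by rw [NatOrdinal.mul_comm', NatOrdinal.mul_one']
  mul_one := NatOrdinal.mul_one'
  mul_comm := NatOrdinal.mul_comm'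

end NatOrdinal

/-! ### Surintegers and surrationals -/

/-- The surintegers `ℤ_∞`: the Grothendieck ring (formal differences) of the ordinals under the
natural sum and product. It carries the order in which `a - b ≤ c - d` iff `a + d ≤ c + b`. -/
def Surinteger : Type (u + 1) := Algebra.GrothendieckAddGroup NatOrdinal.{u}

namespace Surinteger

noncomputable instance : AddCommGroup Surinteger.{u} :=
  inferInstanceAs (AddCommGroup (Algebra.GrothendieckAddGroup NatOrdinal.{u}))

noncomputable instance : LinearOrder Surinteger.{u} :=
  inferInstanceAs (LinearOrder (Algebra.GrothendieckAddGroup NatOrdinal.{u}))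

instance : IsOrderedCancelAddMonoid Surinteger.{u} :=
  inferInstanceAs (IsOrderedCancelAddMonoid (Algebra.GrothendieckAddGroup NatOrdinal.{u}))

instance : IsOrderedAddMonoid Surinteger.{u} := inferInstance

/-- The inclusion of the ordinals into the surintegers. -/
noncomputable def of : NatOrdinal.{u} →+ Surinteger.{u} := Algebra.GrothendieckAddGroup.of

theorem exists_of_sub_of (x : Surinteger.{u}) : ∃ a b, x = of a - of b := by
  have h : ∀ x : Algebra.GrothendieckAddGroup NatOrdinal.{u}, ∃ a b,
      x = Algebra.GrothendieckAddGroup.of a - Algebra.GrothendieckAddGroup.of b := by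
    intro x
    induction x using AddLocalization.ind with
    | H y =>
      refine ⟨y.1, y.2, ?_⟩
      simp only [Algebra.GrothendieckAddGroup.of, AddSubmonoid.LocalizationMap.toAddMonoidHom_apply,
        ← AddLocalization.mk_zero_eq_addMonoidOf_mk, Algebra.GrothendieckAddGroup.mk_sub_mk]
      rw [AddLocalization.mk_eq_mk_iff, AddLocalization.r_iff_exists]
      exact ⟨0, by simp⟩
  exact h x

theorem of_lt_of {a b : NatOrdinal.{u}} : of a < of b ↔ a < b := by
  have h : (AddLocalization.mk a 0 : Algebra.GrothendieckAddGroup NatOrdinal.{u}) <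
      AddLocalization.mk b 0 ↔ a < b := by
    rw [AddLocalization.mk_lt_mk]
    simp
  exact h

/-- The additive maps out of the surintegers that extend a given one on the ordinals. -/
noncomputable def lift {A : Type*} [AddCommGroup A] (f : NatOrdinal.{u} →+ A) :
    Surinteger.{u} →+ A := Algebra.GrothendieckAddGroup.lift f

theorem lift_of {A : Type*} [AddCommGroup A] (f : NatOrdinal.{u} →+ A) (a : NatOrdinal.{u}) :
    lift f (of a) = f a :=
  DFunLike.congr_fun (Algebra.GrothendieckAddGroup.lift.symm_apply_apply f) a

theorem lift_eq {A : Type*} [AddCommGroup A] {f : NatOrdinal.{u} →+ A} {g : Surinteger.{u} →+ A}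
    (h : ∀ a, f a = g (of a)) : lift f = g := by
  ext x
  obtain ⟨a, b, rfl⟩ := exists_of_sub_of x
  simp only [map_sub, lift_of, h]

/-- The multiplication of surintegers, as the biadditive extension of the natural product. -/
noncomputable def mulHom : Surinteger.{u} →+ Surinteger.{u} →+ Surinteger.{u} :=
  lift
    { toFun := fun a => lift (of.comp (AddMonoidHom.mulLeft a))
      map_zero' := lift_eq fun b => by simp
      map_add' := fun a b => lift_eq fun c => by simp [lift_of, add_mul] }

noncomputable instance : Mul Surinteger.{u} := ⟨fun x y => mulHom x y⟩

noncomputable instance : One Surinteger.{u} := ⟨of 1⟩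

theorem of_mul_of (a b : NatOrdinal.{u}) : of a * of b = of (a * b) := by
  change mulHom (of a) (of b) = _
  simp [mulHom, lift_of]

protected theorem mul_add' (x y z : Surinteger.{u}) : x * (y + z) = x * y + x * z :=
  map_add (mulHom x) y z

protected theorem mul_sub' (x y z : Surinteger.{u}) : x * (y - z) = x * y - x * z :=
  map_sub (mulHom x) y z

protected theorem sub_mul' (x y z : Surinteger.{u}) : (x - y) * z = x * z - y * z := by
  change mulHom (x - y) z = mulHom x z - mulHom y z
  simp

protected theorem mul_comm' (x y : Surinteger.{u}) : x * y = y * x := by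
  obtain ⟨a, b, rfl⟩ := exists_of_sub_of x
  obtain ⟨c, d, rfl⟩ := exists_of_sub_of y
  simp only [Surinteger.sub_mul', Surinteger.mul_sub', of_mul_of, mul_comm c, mul_comm d]
  abel

protected theorem mul_assoc' (x y z : Surinteger.{u}) : x * y * z = x * (y * z) := by
  obtain ⟨a, b, rfl⟩ := exists_of_sub_of x
  obtain ⟨c, d, rfl⟩ := exists_of_sub_of y
  obtain ⟨e, f, rfl⟩ := exists_of_sub_of z
  simp only [Surinteger.sub_mul', Surinteger.mul_sub', of_mul_of, mul_assoc]

protected theorem mul_one' (x : Surinteger.{u}) : x * 1 = x := by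
  obtain ⟨a, b, rfl⟩ := exists_of_sub_of x
  change _ * of 1 = _
  simp only [Surinteger.sub_mul', of_mul_of, mul_one]

noncomputable instance : CommRing Surinteger.{u} where
  __ : AddCommGroup Surinteger.{u} := inferInstance
  left_distrib := Surinteger.mul_add'
  right_distrib x y z := by
    rw [Surinteger.mul_comm', Surinteger.mul_add', Surinteger.mul_comm' z, Surinteger.mul_comm' z]
  zero_mul x := by
    have h := Surinteger.sub_mul' 0 0 x
    rwa [sub_self, sub_self] at h
  mul_zero x := by
    have h := Surinteger.mul_sub' x 0 0
    rwa [sub_self, sub_self] at h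
  mul_assoc := Surinteger.mul_assoc'
  one_mul x := by rw [Surinteger.mul_comm', Surinteger.mul_one']
  mul_one := Surinteger.mul_one'
  mul_comm := Surinteger.mul_comm'

theorem zero_lt_one' : (0 : Surinteger.{u}) < 1 := by
  change _ < of 1
  rw [← map_zero of]
  exact of_lt_of.2 NatOrdinal.zero_lt_one'

protected theorem mul_pos' (x y : Surinteger.{u}) (hx : 0 < x) (hy : 0 < y) : 0 < x * y := by
  obtain ⟨a, b, rfl⟩ := exists_of_sub_of x
  obtain ⟨c, d, rfl⟩ := exists_of_sub_of y
  rw [sub_pos, of_lt_of] at hx hy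
  have h := of_lt_of.2 (NatOrdinal.nmul_spec hx hy)
  simp only [map_add, ← of_mul_of] at h
  rw [← sub_pos] at h
  convert h using 1
  ring

instance : Nontrivial Surinteger.{u} := ⟨0, 1, zero_lt_one'.ne⟩

instance : ZeroLEOneClass Surinteger.{u} := ⟨zero_lt_one'.le⟩

instance : IsStrictOrderedRing Surinteger.{u} := IsStrictOrderedRing.of_mul_pos Surinteger.mul_pos'

end Surinteger

/-- The surrationals `ℚ_∞`: the field of fractions of the surintegers. -/
abbrev Surrational : Type (u + 1) := FractionRing Surinteger.{u}

/-! ### Naked polynomials -/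

/-- The naked polynomial ring `F[X^{G⁺}]`: functions from the nonnegative part of `G` to `F` such
that every nonempty subset of the support has a maximum, with coordinatewise sum and with the
product `(p * q)_γ = ∑_{α + β = γ} p_α q_β`. These are the Hahn series whose exponents lie in the
nonnegative part of `G` with the order reversed. -/
abbrev NakedPolynomial (F G : Type*) [Zero F] [AddCommGroup G] [LinearOrder G] : Type _ :=
  HahnSeries ({g : G // 0 ≤ g})ᵒᵈ F

namespace NakedPolynomial

section

variable {F G : Type*} [Zero F] [AddCommGroup G] [LinearOrder G]

/-- The coefficient `p_α` of `p` at the exponent `α`. -/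
def coord (p : NakedPolynomial F G) (α : {g : G // 0 ≤ g}) : F := p.coeff (OrderDual.toDual α)

/-- The support `{α | p_α ≠ 0}`. -/
def supp (p : NakedPolynomial F G) : Set {g : G // 0 ≤ g} := {α | p.coord α ≠ 0}

/-- The degree of `p`, the largest exponent in its support; the zero polynomial, which has no such
exponent, is assigned `0`. -/
noncomputable def degree (p : NakedPolynomial F G) : {g : G // 0 ≤ g} :=
  OrderDual.ofDual (HahnSeries.order p)

theorem exists_isGreatest (p : NakedPolynomial F G) (A : Set {g : G // 0 ≤ g})
    (hA : A ⊆ p.supp) (hne : A.Nonempty) : ∃ x, IsGreatest A x := by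
  have hA' : (OrderDual.ofDual ⁻¹' A).IsWF := p.isWF_support.mono hA
  exact ⟨OrderDual.ofDual (hA'.min hne), hA'.min_mem hne, fun y hy => hA'.min_le hne hy⟩

/-- Every function whose support has the maximum property is a naked polynomial. -/
theorem exists_coord_eq (f : {g : G // 0 ≤ g} → F)
    (hf : ∀ A ⊆ {α | f α ≠ 0}, A.Nonempty → ∃ x, IsGreatest A x) :
    ∃! p : NakedPolynomial F G, p.coord = f := by
  refine ⟨⟨fun α => f (OrderDual.ofDual α), ?_⟩, rfl, fun q hq => ?_⟩
  · rw [Set.isPWO_iff_isWF, Set.isWF_iff_no_descending_seq]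
    intro e he hmem
    obtain ⟨x, ⟨n, rfl⟩, hx⟩ := hf (Set.range fun n => OrderDual.ofDual (e n))
      (by rintro _ ⟨n, rfl⟩; exact hmem n) (Set.range_nonempty _)
    exact absurd (hx ⟨n + 1, rfl⟩) (not_le.2 (OrderDual.ofDual_lt_ofDual.2 (he n.lt_succ_self)))
  · ext α
    exact congrFun hq (OrderDual.ofDual α)

theorem isGreatest_degree {p : NakedPolynomial F G} (hp : p ≠ 0) :
    IsGreatest p.supp p.degree :=
  ⟨HahnSeries.coeff_order_eq_zero.not.2 hp,
    fun _ hy => HahnSeries.order_le_of_coeff_ne_zero hy⟩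

end

end NakedPolynomial

/-! ### Euclidean domains with a norm in an ordered class -/

/-- The commutative ring `R` is a Euclidean domain with norm `N`, where `N` takes values in a
linearly ordered class that need not be well-ordered: `R` is an integral domain, division with
remainder is possible by every nonzero element, and `N` does not decrease under multiplication by
nonzero elements. -/
structure IsEuclideanDomainWithNorm {R Γ : Type*} [CommRing R] [LinearOrder Γ] (N : R → Γ) :
    Prop where
  isDomain : IsDomain R
  exists_quotient_remainder : ∀ a b : R, b ≠ 0 →
    ∃ q r : R, a = b * q + r ∧ (r = 0 ∨ N r < N b)
  norm_le_norm_mul : ∀ a b : R, a ≠ 0 → b ≠ 0 → N a ≤ N (a * b)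

namespace NakedPolynomial

/-! Division needs no recursion on degrees, so the lack of a well-order on the exponents does no
harm. Allowing negative exponents as well turns naked polynomials into a subring of the field of
Hahn series over `Gᵒᵈ`, where the quotient y = p/q exists outright. Let r be the part of y with
nonnegative exponents. Then y - r has only negative exponents (`orderTop_sub_nonnegPart_pos`), so p
- qr = q(y - r) is zero or has degree below that of q; it is a naked polynomial because p, q and r
are.

The same embedding gives the absence of zero divisors and, through the order of a product,
additivity of the degree (`degree_mul`). Since degrees are nonnegative, a nonzero multiple of q has
degree at least that of q. This is the norm inequality, and it forces uniqueness: two divisions give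
q(r - r') = s' - s, whose right side has too small a degree unless it vanishes. -/

/-- Both coefficients at any exponent from `d` upwards vanish, so the leading exponent of the
difference lies below `d`. The difference must be nonzero: for `d = 0` the convention that zero has
degree 0 would break the strict inequality. -/
theorem degree_sub_lt {F G : Type*} [AddGroup F] [AddCommGroup G] [LinearOrder G]
    {s t : NakedPolynomial F G} {d : {g : G // 0 ≤ g}} (hst : s - t ≠ 0)
    (hs : s = 0 ∨ s.degree < d) (ht : t = 0 ∨ t.degree < d) : (s - t).degree < d := by
  have hcoord : ∀ x : NakedPolynomial F G, (x = 0 ∨ x.degree < d) → ∀ a, d ≤ a →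
      x.coord a = 0 := by
    rintro x (rfl | hx) a ha
    · rfl
    · exact HahnSeries.coeff_eq_zero_of_lt_order (hx.trans_le ha)
  by_contra! hle
  refine (isGreatest_degree hst).1 ?_
  change s.coord _ - t.coord _ = 0
  rw [hcoord s hs _ hle, hcoord t ht _ hle, sub_zero]

/-! ### Embedding into the field of Hahn series -/

section Field

variable {F G : Type*} [Field F] [AddCommGroup G] [LinearOrder G] [IsOrderedAddMonoid G]

/-- The inclusion of the nonnegative exponents into all exponents, with the orders reversed. -/
def exponentHom (G : Type*) [AddCommGroup G] [LinearOrder G] [IsOrderedAddMonoid G] :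
    ({g : G // 0 ≤ g})ᵒᵈ →+ Gᵒᵈ where
  toFun g := OrderDual.toDual (OrderDual.ofDual g).1
  map_zero' := rfl
  map_add' _ _ := rfl

theorem exponentHom_injective : Function.Injective (exponentHom G) :=
  fun _ _ h => Subtype.coe_injective h

/-- The inclusion of the naked polynomials into the field of Hahn series with arbitrary
exponents. -/
noncomputable def toHahnSeries : NakedPolynomial F G →+* HahnSeries Gᵒᵈ F :=
  HahnSeries.embDomainRingHom (exponentHom G) exponentHom_injective fun _ _ => Iff.rfl

theorem toHahnSeries_injective :
    Function.Injective (toHahnSeries : NakedPolynomial F G →+* HahnSeries Gᵒᵈ F) :=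
  HahnSeries.embDomain_injective

theorem toHahnSeries_coeff (p : NakedPolynomial F G) (a : ({g : G // 0 ≤ g})ᵒᵈ) :
    (toHahnSeries p).coeff (exponentHom G a) = p.coeff a :=
  HahnSeries.embDomain_coeff

/-- Translates degrees into orders of Hahn series. Zero is excluded because its `orderTop` is `⊤`
while its degree is 0 by convention. -/
theorem orderTop_toHahnSeries {p : NakedPolynomial F G} (hp : p ≠ 0) :
    (toHahnSeries p).orderTop = exponentHom G (OrderDual.toDual p.degree) := by
  refine HahnSeries.orderTop_embDomain.trans ?_
  rw [← HahnSeries.order_eq_orderTop_of_ne_zero hp]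
  rfl

/-- The part of a Hahn series with nonnegative exponents, as a naked polynomial. -/
def nonnegPart (x : HahnSeries Gᵒᵈ F) : NakedPolynomial F G where
  coeff a := x.coeff (exponentHom G a)
  isPWO_support' := by
    rw [Set.isPWO_iff_isWF, Set.isWF_iff_no_descending_seq]
    intro e he hmem
    exact Set.isWF_iff_no_descending_seq.1 x.isWF_support (fun n => exponentHom G (e n))
      (fun _ _ h => he h) hmem

/-- Only negative exponents survive the subtraction, and these are the positive elements of `Gᵒᵈ`.
With `orderTop` the statement also covers a zero difference, which occurs when a division is exact.
-/
theorem orderTop_sub_nonnegPart_pos (x : HahnSeries Gᵒᵈ F) :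
    0 < (x - toHahnSeries (nonnegPart x)).orderTop := by
  by_cases h : x - toHahnSeries (nonnegPart x) = 0
  · rw [h, HahnSeries.orderTop_zero]
    exact WithTop.coe_lt_top _
  rw [HahnSeries.zero_lt_orderTop_iff h]
  by_contra! hle
  refine HahnSeries.coeff_order_eq_zero.not.2 h ?_
  rw [HahnSeries.coeff_sub, sub_eq_zero]
  -- Read in `G`, `hle` says that the leading exponent is nonnegative, so it belongs to the
  -- exponents at which the two series agree.
  exact (toHahnSeries_coeff (nonnegPart x) (OrderDual.toDual ⟨OrderDual.ofDual _, hle⟩)).symm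

/-! ### Integrality and the degree of a product -/

theorem isDomain : IsDomain (NakedPolynomial F G) :=
  toHahnSeries_injective.isDomain toHahnSeries

theorem degree_mul {p q : NakedPolynomial F G} (hp : p ≠ 0) (hq : q ≠ 0) :
    (p * q).degree = p.degree + q.degree := by
  have := isDomain (F := F) (G := G)
  have h := orderTop_toHahnSeries (mul_ne_zero hp hq)
  rw [map_mul, HahnSeries.orderTop_mul, orderTop_toHahnSeries hp, orderTop_toHahnSeries hq,
    ← WithTop.coe_add, WithTop.coe_inj, ← map_add] at h
  exact (OrderDual.toDual_inj.1 (exponentHom_injective h)).symm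

theorem degree_le_degree_mul {p q : NakedPolynomial F G} (hp : p ≠ 0) (hq : q ≠ 0) :
    p.degree ≤ (p * q).degree := by
  rw [degree_mul hp hq]
  exact le_add_of_nonneg_right q.degree.2

/-! ### Existence and uniqueness of division -/

/-- Division with remainder: the quotient is the nonnegative part of the quotient in the field of
Hahn series. -/
theorem exists_eq_mul_add (p : NakedPolynomial F G) {q : NakedPolynomial F G} (hq : q ≠ 0) :
    ∃ r s : NakedPolynomial F G, p = q * r + s ∧ (s = 0 ∨ s.degree < q.degree) := by
  have hq' : toHahnSeries q ≠ 0 := (map_ne_zero_iff _ toHahnSeries_injective).2 hq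
  set y := toHahnSeries p / toHahnSeries q with hy
  refine ⟨nonnegPart y, p - q * nonnegPart y, by ring, or_iff_not_imp_left.2 fun hs => ?_⟩
  have h : toHahnSeries (p - q * nonnegPart y) =
      toHahnSeries q * (y - toHahnSeries (nonnegPart y)) := by
    rw [map_sub, map_mul, mul_sub, hy, mul_div_cancel₀ _ hq']
  have hlt : (toHahnSeries q).orderTop < (toHahnSeries (p - q * nonnegPart y)).orderTop := by
    rw [h, HahnSeries.orderTop_mul, orderTop_toHahnSeries hq]
    -- The order of `q` is finite, so adding it to both sides of the positivity of the order of y -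
    -- r keeps the inequality strict.
    simpa using (WithTop.add_lt_add_iff_left WithTop.coe_ne_top).2
      (orderTop_sub_nonnegPart_pos y)
  rw [orderTop_toHahnSeries hq, orderTop_toHahnSeries hs, WithTop.coe_lt_coe] at hlt
  -- The inequality is one in `Gᵒᵈ`; unfolding the reversal makes it the bound on degrees.
  exact hlt

/-- If the quotients differed, the difference of the remainders would be a nonzero multiple of `q`
of degree below that of `q`. -/
theorem eq_of_mul_add_eq_mul_add {q r r' s s' : NakedPolynomial F G} (hq : q ≠ 0)
    (h : q * r + s = q * r' + s') (hs : s = 0 ∨ s.degree < q.degree)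
    (hs' : s' = 0 ∨ s'.degree < q.degree) : r = r' ∧ s = s' := by
  have := isDomain (F := F) (G := G)
  have hmul : q * (r - r') = s' - s := by linear_combination h
  have hr : r = r' := by
    by_contra hne
    have hne' := sub_ne_zero.2 hne
    have hlt := degree_sub_lt (hmul ▸ mul_ne_zero hq hne') hs' hs
    rw [← hmul] at hlt
    exact (degree_le_degree_mul hq hne').not_gt hlt
  subst hr
  exact ⟨rfl, add_left_cancel h⟩

theorem existsUnique_eq_mul_add (p : NakedPolynomial F G) {q : NakedPolynomial F G}
    (hq : q ≠ 0) :
    ∃! rs : NakedPolynomial F G × NakedPolynomial F G,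
      p = q * rs.1 + rs.2 ∧ (rs.2 = 0 ∨ rs.2.degree < q.degree) := by
  obtain ⟨r, s, h, hs⟩ := exists_eq_mul_add p hq
  refine ⟨(r, s), ⟨h, hs⟩, fun rs hrs => ?_⟩
  obtain ⟨h₁, h₂⟩ := eq_of_mul_add_eq_mul_add hq (hrs.1.symm.trans h) hrs.2 hs
  exact Prod.ext h₁ h₂

theorem isEuclideanDomainWithNorm_degree :
    IsEuclideanDomainWithNorm (degree (F := F) (G := G)) where
  isDomain := isDomain
  exists_quotient_remainder p _ hq := exists_eq_mul_add p hq
  norm_le_norm_mul _ _ := degree_le_degree_mul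

end Field

end NakedPolynomial

/-- The surintegers enter as an ordered abelian group of exponents, the surrationals as a
coefficient field; the general results then apply. -/
theorem theorem4p5 :
    (∀ p q : NakedPolynomial Surrational.{u} Surinteger.{u}, q ≠ 0 → q.degree ≤ p.degree →
      ∃! rs : NakedPolynomial Surrational.{u} Surinteger.{u} ×
          NakedPolynomial Surrational.{u} Surinteger.{u},
        p = q * rs.1 + rs.2 ∧ (rs.2 = 0 ∨ rs.2.degree < q.degree)) ∧
    IsEuclideanDomainWithNorm
      (NakedPolynomial.degree (F := Surrational.{u}) (G := Surinteger.{u})) :=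
  ⟨fun p _ hq _ => NakedPolynomial.existsUnique_eq_mul_add p hq,
    NakedPolynomial.isEuclideanDomainWithNorm_degree⟩
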